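/- Let $d\ge 0$, let $R_d=\mathbb{Z}[u_1^{\pm1},\dots,u_d^{\pm1}]$, and write $u^{\mathbf n}=u_1^{n_1}\cdots u_d^{n_d}$ for $\mathbf n\in\mathbb{Z}^d$. Let $\mathfrak p\subset R_d$ be a prime ideal such that $M=R_d/\mathfrak p$ has Krull dimension $1$. Let $X=\widehat M$ be the compact (Pontryagin) dual group of the discrete abelian group $M$, with Haar probability measure $\mu$, and let $\alpha^{\mathbf n}$ be the automorphism of $X$ dual to multiplication by $u^{\mathbf n}$ on $M$. Assume that the $\mathbb{Z}^d$-action $\alpha$ is mixing, that is, $\mu(A\cap\alpha^{-\mathbf n}B)\to\mu(A)\mu(B)$ as $\mathbf n\to\infty$ in $\mathbb{Z}^d$ for all Borel sets $A,B\subset X$. Let $\mathbb K$ be the field of fractions of $M$. For every place $v$ of $\mathbb K$ (an equivalence class of nontrivial real-valued absolute values) fix a normalised absolute value $|\cdot|_v$, that is, some positive power of an absolute value representing $v$. Let $S(\mathfrak p)$ be the set of places $v$ of $\mathbb K$ for which $\{|a|_v : a\in M\}$ is unbounded. Let $\theta(1)\le\theta(2)\le\cdots$ be positive real numbers with $\theta(k)\to\infty$,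 and put \[ H_k=\{a\in M : \theta(k)^{-1}\le |a|_v\le\theta(k)\text{ for all }v\in S(\mathfrak p)\}\cup\{0\}. \] Then $H_1\subset H_2\subset\cdots$ is an increasing sequence of finite subsets of $M$ with $\bigcup_k H_k=M$, and there is a constant $B>0$ such that, for all $k$ and all $\mathbf n\in\mathbb{Z}^d$ with $\|\mathbf n\|>B\log\theta(k)$ (Euclidean norm), \[ H_k\cap u^{\mathbf n}H_k=\{0\}. \] -/

import Mathlib

open Filter Topology MeasureTheory

namespace AlgebraicAction

/-- The ring `R_d = ℤ[u₁^{±1}, …, u_d^{±1}]` of integer Laurent polynomials in `d` commuting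
variables: the group ring of `ℤ^d`, with exponent vectors in `Fin d → ℤ`. -/
abbrev LaurentRing (d : ℕ) : Type := AddMonoidAlgebra ℤ (Fin d → ℤ)

/-- The monomial `u^n = u₁^{n₁} ⋯ u_d^{n_d}`. -/
noncomputable def u {d : ℕ} (n : Fin d → ℤ) : LaurentRing d := AddMonoidAlgebra.single n 1

/-- The Euclidean norm of an integer vector. -/
noncomputable def vecNorm {d : ℕ} (n : Fin d → ℤ) : ℝ := Real.sqrt (∑ i, (n i : ℝ) ^ 2)

section Dual

/-- The additive group of `M`, written multiplicatively and with the discrete topology. -/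
def DiscreteGroup (M : Type*) : Type _ := Multiplicative M

instance (M : Type*) [AddCommGroup M] : CommGroup (DiscreteGroup M) :=
  inferInstanceAs (CommGroup (Multiplicative M))

instance (M : Type*) : TopologicalSpace (DiscreteGroup M) := ⊥

instance (M : Type*) : DiscreteTopology (DiscreteGroup M) := ⟨rfl⟩

/-- The compact abelian group `X` whose character group is the discrete group `M`. -/
abbrev DualGroup (M : Type*) [AddCommGroup M] : Type _ := PontryaginDual (DiscreteGroup M)

noncomputable instance (M : Type*) [AddCommGroup M] : MeasurableSpace (DualGroup M) := borel _

instance (M : Type*) [AddCommGroup M] : BorelSpace (DualGroup M) := ⟨rfl⟩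

/-- Haar measure on the dual group, normalised to have total mass one. -/
noncomputable def dualHaar (M : Type*) [AddCommGroup M] : Measure (DualGroup M) :=
  Measure.haarMeasure ⊤

/-- The automorphism `α^n` of the dual group of an `R_d`-module `M` that is dual to
multiplication by `u^n` on `M`. -/
noncomputable def dualAction {d : ℕ} (M : Type*) [AddCommGroup M] [Module (LaurentRing d) M]
    (n : Fin d → ℤ) : DualGroup M →ₜ* DualGroup M :=
  PontryaginDual.map
    { toMonoidHom := AddMonoidHom.toMultiplicative (DistribSMul.toAddMonoidHom M (u n))
      continuous_toFun := continuous_of_discreteTopology }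

/-- The `R_d`-module `M` corresponds to a mixing `ℤ^d`-action: on the compact dual group with
its Haar probability measure `μ`, one has `μ (A ∩ α^{-n} B) → μ A * μ B` as `n → ∞` in `ℤ^d`,
for all Borel sets `A` and `B`. -/
def IsMixingModule (d : ℕ) (M : Type*) [AddCommGroup M] [Module (LaurentRing d) M] : Prop :=
  ∀ A B : Set (DualGroup M), MeasurableSet A → MeasurableSet B →
    Tendsto (fun n : Fin d → ℤ => dualHaar M (A ∩ dualAction M n ⁻¹' B)) cofinite
      (𝓝 (dualHaar M A * dualHaar M B))

end Dual

section Places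

/-- Equivalence of nontrivial absolute values on a field. -/
instance placeSetoid (K : Type*) [Field K] :
    Setoid {w : AbsoluteValue K ℝ // w.IsNontrivial} where
  r v w := v.1.IsEquiv w.1
  iseqv := ⟨fun v => .refl v.1, fun h => h.symm, fun h h' => h.trans h'⟩

/-- The places of a field: equivalence classes of nontrivial absolute values. -/
def Place (K : Type*) [Field K] : Type _ := Quotient (placeSetoid K)

/-- `N v` is a normalised absolute value `|·|_v` of each place `v`: a positive power of an
absolute value that represents `v`. (Powers are allowed so that the square of the usual absolute
value at a complex place, as in the product formula, is included.) -/
def IsNormalization {K : Type*} [Field K] (N : Place K → K → ℝ) : Prop :=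
  ∀ v : Place K, ∃ w : {w : AbsoluteValue K ℝ // w.IsNontrivial},
    Quotient.mk (placeSetoid K) w = v ∧ ∃ c : ℝ, 0 < c ∧ ∀ x : K, N v x = w.1 x ^ c

/-- Every field has a normalisation of its places. -/
theorem exists_isNormalization (K : Type*) [Field K] :
    ∃ N : Place K → K → ℝ, IsNormalization N :=
  ⟨fun v x => (Quotient.out v).1 x, fun v =>
    ⟨Quotient.out v, Quotient.out_eq v, 1, one_pos, fun _ => (Real.rpow_one _).symm⟩⟩

/-- The set `S` of places of the field of fractions of `D` that are unbounded on `D`. -/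
def unboundedPlaces (D : Type*) [CommRing D] [IsDomain D]
    (N : Place (FractionRing D) → FractionRing D → ℝ) : Set (Place (FractionRing D)) :=
  {v | ¬ BddAbove (Set.range fun a : D => N v (algebraMap D (FractionRing D) a))}

/-- The elements `a` of `D` with `t⁻¹ ≤ |a|_v ≤ t` for all places `v` that are unbounded on `D`,
together with `0`. -/
def placeBox (D : Type*) [CommRing D] [IsDomain D]
    (N : Place (FractionRing D) → FractionRing D → ℝ) (t : ℝ) : Set D :=
  {a | ∀ v ∈ unboundedPlaces D N,
    t⁻¹ ≤ N v (algebraMap D (FractionRing D) a) ∧ N v (algebraMap D (FractionRing D) a) ≤ t} ∪ {0}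

end Places

/-- An increasing sequence of finite subsets of `M` with union `M`. -/
def IsExhaustive {M : Type*} (H : ℕ → Set M) : Prop :=
  Monotone H ∧ (∀ k, (H k).Finite) ∧ ⋃ k, H k = Set.univ

/-- Directional uniformity of mixing for the sets `H k`, with rate function `φ`:
`H k ∩ u^n (H k) = {0}` for all `n` with `‖n‖ > φ k`. -/
def UniformMixing (d : ℕ) {M : Type*} [AddCommGroup M] [Module (LaurentRing d) M]
    (H : ℕ → Set M) (φ : ℕ → ℝ) : Prop :=
  ∀ (k : ℕ) (n : Fin d → ℤ), φ k < vecNorm n → H k ∩ (fun a => u n • a) '' H k = {0}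

end AlgebraicAction

/-! The domain `M = R_d/𝔭` is finitely generated of dimension one, so its fraction field `K` is a
finite extension of `F = Frac A`, where `A` is `ℤ` in characteristic zero and `𝔽_p[t]`, with `t ∈ M`
transcendental, in characteristic `p`. For a suitable nonzero `D ∈ A`, every element of `M` becomes
integral over `A` after multiplication by a power of `D`. A place unbounded on `M` therefore lies
over infinity or over a prime dividing `D`, and there are finitely many of these
(`finite_unbounded_places`).

Bounding `|a|_v` on `S(𝔭)` bounds `a` at every place, since the other places are at most one on `M`.
One power of `D` then clears all denominators, and the conjugates at infinity are bounded, so only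
finitely many minimal polynomials occur (`finite_upperBox`). This gives finiteness of the sets
`H_k`.

Mixing makes `n ↦ u^n ∈ M` injective (`exists_u_smul_ne_of_isMixingModule`). The homomorphism `l(n)
= (log |u^n|_v)_{v ∈ S(𝔭)}` thus has finite sublevel sets, which forces `‖n‖ ≤ c‖l(n)‖`
(`exists_vecNorm_le_of_finite_sublevels`). If `a` and `u^n a` are nonzero elements of `H_k`, then
`‖l(n)‖ ≤ 2 log θ(k)`; hence `B = 2c` works. -/

namespace AlgebraicAction

/-! ### Nonarchimedean absolute values: integrality and extension. -/

section Nonarchimedean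

theorem isNonarchimedean_of_natCast_le_one {K : Type*} [Field K] (v : AbsoluteValue K ℝ)
    (h : ∀ n : ℕ, v n ≤ 1) : IsNonarchimedean v := by
  have : IsUltrametricDist (WithAbs v) := by
    refine IsUltrametricDist.isUltrametricDist_of_forall_norm_natCast_le_one fun n => ?_
    rw [WithAbs.norm_eq_apply_ofAbs]
    have hn : (n : WithAbs v).ofAbs = (n : K) := map_natCast (WithAbs.equiv v) n
    exact hn ▸ h n
  intro x y
  have := IsUltrametricDist.isNonarchimedean_norm (WithAbs.toAbs v x) (WithAbs.toAbs v y)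
  simpa [WithAbs.norm_eq_apply_ofAbs] using this

theorem isNonarchimedean_of_le_one {A K : Type*} [CommRing A] [Field K] [Algebra A K]
    (v : AbsoluteValue K ℝ) (h : ∀ a : A, v (algebraMap A K a) ≤ 1) : IsNonarchimedean v :=
  isNonarchimedean_of_natCast_le_one v fun n => by simpa using h n

/-- The closed unit ball of a nonarchimedean absolute value, as a subring. -/
def unitBall {K : Type*} [Field K] (v : AbsoluteValue K ℝ) (hv : IsNonarchimedean v) :
    Subring K where
  carrier := {x | v x ≤ 1}
  mul_mem' {a b} ha hb := by
    simp only [Set.mem_ofPred_eq, map_mul] at *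
    exact mul_le_one₀ ha (v.nonneg b) hb
  one_mem' := by simp
  add_mem' {a b} ha hb := (hv a b).trans (max_le ha hb)
  zero_mem' := by simp
  neg_mem' {a} ha := by simpa using ha

/-- If `v x > 1`, the leading term of a monic equation strictly dominates all the others. -/
theorem le_one_of_isIntegral {A K : Type*} [CommRing A] [Field K] [Algebra A K]
    (v : AbsoluteValue K ℝ) (h : ∀ a : A, v (algebraMap A K a) ≤ 1) {x : K}
    (hx : IsIntegral A x) : v x ≤ 1 := by
  have hna := isNonarchimedean_of_le_one v h
  obtain ⟨p, hp, hpx⟩ := hx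
  by_contra! hlt
  rw [Polynomial.eval₂_eq_sum_range, Finset.sum_range_succ, hp.coeff_natDegree, map_one, one_mul,
    add_eq_zero_iff_neg_eq] at hpx
  have h0 : v (x ^ p.natDegree) = v (∑ i ∈ Finset.range p.natDegree,
      algebraMap A K (p.coeff i) * x ^ i) := by rw [← hpx, v.map_neg]
  rcases Nat.eq_zero_or_pos p.natDegree with hd | hd
  · simp [hd] at h0
  · have hne : (Finset.range p.natDegree).Nonempty := by simpa using hd.ne'
    have h1 := hna.apply_sum_le_sup hne (l := fun i => algebraMap A K (p.coeff i) * x ^ i)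
    rw [← h0] at h1
    obtain ⟨i, hi, hle⟩ := (Finset.le_sup'_iff hne).1 h1
    rw [map_mul, map_pow, map_pow] at hle
    have h2 : v x ^ i < v x ^ p.natDegree := pow_lt_pow_right₀ hlt (Finset.mem_range.1 hi)
    have h3 : v (algebraMap A K (p.coeff i)) * v x ^ i ≤ 1 * v x ^ i := by gcongr; exact h _
    linarith

/-- Each factor `X - z` has coefficients in the subring `unitBall`, hence so does the product. -/
theorem coeff_le_one_of_roots_le_one {L : Type*} [Field L] (v : AbsoluteValue L ℝ)
    (hv : IsNonarchimedean v) (p : Polynomial L) (hp : p.Monic) (hs : p.Splits)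
    (h : ∀ z ∈ p.roots, v z ≤ 1) (i : ℕ) : v (p.coeff i) ≤ 1 := by
  have hmem : p ∈ Polynomial.lifts (unitBall v hv).subtype := by
    rw [hs.eq_prod_roots_of_monic hp]
    refine multiset_prod_mem _ fun q hq => ?_
    obtain ⟨z, hz, rfl⟩ := Multiset.mem_map.1 hq
    refine (Polynomial.lifts_iff_liftsRing _ _).2 (sub_mem ?_ ?_)
    · exact (Polynomial.lifts_iff_liftsRing _ _).1 (Polynomial.X_mem_lifts _)
    · exact (Polynomial.lifts_iff_liftsRing _ _).1
        (Polynomial.C_mem_lifts (unitBall v hv).subtype ⟨z, h z hz⟩)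
  obtain ⟨y, hy⟩ := (Polynomial.lifts_iff_coeff_lifts p).1 hmem i
  rw [← hy]
  exact y.2

/-- The norm of a normed field as an absolute value. -/
noncomputable def normAbs (L : Type*) [NormedField L] : AbsoluteValue L ℝ where
  toFun := norm
  map_mul' := norm_mul
  nonneg' := norm_nonneg
  eq_zero' _ := norm_eq_zero
  add_le' := norm_add_le

/-- An absolute value on `F` extends to an algebraically closed field containing `F`. -/
def ExtendsToAlgClosed {F : Type} [Field F] (w : AbsoluteValue F ℝ) : Prop :=
  ∃ (L : Type) (_ : NormedField L) (_ : IsAlgClosed L) (f : F →+* L), ∀ x, ‖f x‖ = w x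

/-- Complete, then put the spectral norm on the algebraic closure of the completion. -/
theorem extendsToAlgClosed_of_isNonarchimedean {F : Type} [Field F] (w : AbsoluteValue F ℝ)
    (hw : IsNonarchimedean w) (hnt : w.IsNontrivial) :
    ∃ (L : Type) (_ : NormedField L) (_ : IsAlgClosed L) (f : F →+* L), (∀ x, ‖f x‖ = w x) ∧
      IsNonarchimedean (norm : L → ℝ) := by
  let C := w.Completion
  obtain ⟨x₀, hx₀⟩ := hnt.exists_abv_gt_one
  have hcoe : ∀ x : F, ‖((WithAbs.toAbs w x : WithAbs w) : C)‖ = w x := fun x => by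
    rw [UniformSpace.Completion.norm_coe, WithAbs.norm_eq_apply_ofAbs]
  have hadd : ∀ x y : w.Completion, ‖x + y‖ ≤ max ‖x‖ ‖y‖ := fun x y => by
    induction x, y using UniformSpace.Completion.induction_on₂ with
    | hp => exact isClosed_le (by fun_prop) (by fun_prop)
    | ih a b =>
      rw [← UniformSpace.Completion.coe_add]
      simp only [UniformSpace.Completion.norm_coe, WithAbs.norm_eq_apply_ofAbs]
      exact hw _ _
  let : NontriviallyNormedField C :=
    { (inferInstance : NormedField w.Completion) with
      non_trivial := ⟨_, (hcoe x₀).symm ▸ hx₀⟩ }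
  have : IsUltrametricDist C :=
    IsUltrametricDist.isUltrametricDist_of_forall_norm_add_le_max_norm hadd
  let L := AlgebraicClosure C
  let : NormedField L := spectralNorm.normedField C L
  refine ⟨L, inferInstance, inferInstance,
    ((algebraMap C L).comp UniformSpace.Completion.coeRingHom).comp
      (WithAbs.equiv w).symm.toRingHom, fun x => ?_, ?_⟩
  · exact (spectralNorm_extends (K := C) (L := L) _).trans (hcoe x)
  · exact isNonarchimedean_spectralNorm (K := C) (L := L)

end Nonarchimedean

/-! ### Integrality over a principal ideal domain detected by absolute values. -/

section Integrality

/-- An irreducible factor of the denominator of a reduced fraction gives a prime at which the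
fraction exceeds one. -/
theorem mem_range_of_forall_adicAbv_le_one {A F : Type*} [CommRing A] [IsDomain A]
    [IsPrincipalIdealRing A] [Field F] [Algebra A F] [IsFractionRing A F] (c : F)
    (h : ∀ P : IsDedekindDomain.HeightOneSpectrum A,
      P.adicAbv (K := F) (b := 2) one_lt_two c ≤ 1) : c ∈ Set.range (algebraMap A F) := by
  obtain ⟨a, b, hab, rfl⟩ := IsFractionRing.exists_reduced_fraction A c
  have hb : IsUnit (b : A) := by
    by_contra hb
    obtain ⟨π, hπ, hπb⟩ := WfDvdMonoid.exists_irreducible_factor hb (nonZeroDivisors.coe_ne_zero b)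
    have hπp : Prime π := hπ.prime
    let P : IsDedekindDomain.HeightOneSpectrum A :=
      ⟨Ideal.span {π}, (Ideal.span_singleton_prime hπp.ne_zero).2 hπp, by
        simpa using hπp.ne_zero⟩
    have hbP : (b : A) ∈ P.asIdeal := Ideal.mem_span_singleton.2 hπb
    have haP : a ∉ P.asIdeal := fun ha =>
      hπ.not_isUnit (hab (Ideal.mem_span_singleton.1 ha) hπb)
    have h1 := h P
    have hb1 := (P.adicAbv_coe_lt_one_iff (K := F) (b := 2) one_lt_two (b : A)).2 hbP
    have ha1 := (P.adicAbv_coe_eq_one_iff (K := F) (b := 2) one_lt_two a).2 haP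
    have hb0 : 0 < P.adicAbv (K := F) (b := 2) one_lt_two (algebraMap A F b) :=
      AbsoluteValue.pos _ (IsFractionRing.to_map_ne_zero_of_mem_nonZeroDivisors b.2)
    rw [IsFractionRing.mk'_eq_div, map_div₀, ha1, div_le_one hb0] at h1
    linarith
  obtain ⟨b', hb'⟩ := hb.exists_right_inv
  refine ⟨a * b', ?_⟩
  rw [IsFractionRing.mk'_eq_div,
    eq_div_iff (IsFractionRing.to_map_ne_zero_of_mem_nonZeroDivisors b.2), ← map_mul]
  rw [mul_assoc, mul_comm b', hb', mul_one]

theorem adicAbv_isNontrivial {A F : Type*} [CommRing A] [IsDomain A]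
    [IsPrincipalIdealRing A] [Field F] [Algebra A F] [IsFractionRing A F]
    (P : IsDedekindDomain.HeightOneSpectrum A) :
    (P.adicAbv (K := F) (b := 2) one_lt_two).IsNontrivial := by
  obtain ⟨a, haP, ha0⟩ := Submodule.exists_mem_ne_zero_of_ne_bot P.ne_bot
  exact ⟨algebraMap A F a, by simpa using ha0,
    ((P.adicAbv_coe_lt_one_iff (K := F) (b := 2) one_lt_two a).2 haP).ne⟩

variable {A F K : Type} [CommRing A] [IsDomain A] [IsPrincipalIdealRing A] [Field F] [Field K]
  [Algebra A F] [IsFractionRing A F] [Algebra F K] [Algebra A K] [IsScalarTower A F K]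

/-- For a prime `P` of `A`, the roots of `minpoly F x` in an algebraically closed extension of the
`P`-adic value are the `σ x` for embeddings `σ` of `K`. Pulling the norm back along `σ` gives an
absolute value of `K` to which the hypothesis applies, so the coefficients are `P`-integral for
every `P`. -/
theorem isIntegral_of_forall_le_one [Algebra.IsAlgebraic F K] (x : K)
    (h : ∀ v : AbsoluteValue K ℝ, (∀ a : A, v (algebraMap A K a) ≤ 1) → v x ≤ 1) :
    IsIntegral A x := by
  classical
  have hint : IsIntegral F x := Algebra.IsIntegral.isIntegral x
  have hmem : minpoly F x ∈ Polynomial.lifts (algebraMap A F) := by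
    refine (Polynomial.lifts_iff_coeff_lifts _).2 fun i =>
      mem_range_of_forall_adicAbv_le_one _ fun P => ?_
    obtain ⟨L, _, _, f, hf, hL⟩ := extendsToAlgClosed_of_isNonarchimedean
      (P.adicAbv (K := F) (b := 2) one_lt_two) (P.isNonarchimedean_adicAbv one_lt_two)
      (adicAbv_isNontrivial P)
    let := f.toAlgebra
    have hr : ∀ z ∈ ((minpoly F x).map f).roots, ‖z‖ ≤ 1 := fun z hz => by
      have hz' : z ∈ (minpoly F x).rootSet L := by
        rw [Polynomial.rootSet, Polynomial.aroots, Finset.mem_coe, Multiset.mem_toFinset]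
        exact hz
      rw [← Algebra.IsAlgebraic.range_eval_eq_rootSet_minpoly] at hz'
      obtain ⟨σ, rfl⟩ := hz'
      refine h ((normAbs L).comp (f := σ.toRingHom) σ.toRingHom.injective) fun a => ?_
      change ‖σ (algebraMap A K a)‖ ≤ 1
      rw [IsScalarTower.algebraMap_apply A F K, σ.commutes]
      change ‖f _‖ ≤ 1
      rw [hf]
      exact P.adicAbv_coe_le_one one_lt_two a
    have := coeff_le_one_of_roots_le_one (normAbs L) hL _ ((minpoly.monic hint).map f)
      (IsAlgClosed.splits _) hr i
    rw [Polynomial.coeff_map] at this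
    rw [← hf]
    exact this
  obtain ⟨q, hq, -, hqm⟩ := Polynomial.lifts_and_degree_eq_and_monic hmem (minpoly.monic hint)
  refine ⟨q, hqm, ?_⟩
  have := minpoly.aeval F x
  rw [← hq, Polynomial.aeval_map_algebraMap] at this
  exact this

end Integrality

/-! ### Finitely many places above a given one. -/

section Fibers

variable {F K : Type*} [Field F] [Field K] [Algebra F K]

/-- The restriction of an absolute value to a subfield. -/
noncomputable def restrict (F : Type*) {K : Type*} [Field F] [Field K] [Algebra F K]
    (v : AbsoluteValue K ℝ) : AbsoluteValue F ℝ :=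
  v.comp (algebraMap F K).injective

theorem restrict_apply (v : AbsoluteValue K ℝ) (x : F) :
    restrict F v x = v (algebraMap F K x) := rfl

/-- Weak approximation gives `x i` large at `v i` and small at the other `v j`. High powers of the
`x i` are linearly independent over `F`: in a relation, the term whose coefficient is largest for
`w` dominates at its own place. -/
theorem card_le_finrank_of_restrict_isEquiv [FiniteDimensional F K] {ι : Type*} [Fintype ι]
    (v : ι → AbsoluteValue K ℝ) (w : AbsoluteValue F ℝ) (hnt : ∀ i, (v i).IsNontrivial)
    (hne : Pairwise fun i j => ¬ (v i).IsEquiv (v j))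
    (hw : ∀ i, (restrict F (v i)).IsEquiv w) : Fintype.card ι ≤ Module.finrank F K := by
  classical
  choose x hx1 hx2 using AbsoluteValue.exists_one_lt_lt_one_pi_of_not_isEquiv hnt hne
  have hlim : ∀ i j, j ≠ i → ∃ n₀ : ℕ, ∀ n ≥ n₀, Fintype.card ι * v i (x j) ^ n < 1 := by
    intro i j hij
    have h := (tendsto_pow_atTop_nhds_zero_of_lt_one ((v i).nonneg _)
      (hx2 j i hij.symm)).const_mul (Fintype.card ι : ℝ)
    rw [mul_zero] at h
    exact eventually_atTop.1 (h.eventually (gt_mem_nhds one_pos))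
  choose! n₀ hn₀ using hlim
  -- The sum serves as a common upper bound of all the thresholds.
  let n := ∑ i, ∑ j, n₀ i j
  have hn : ∀ i j, n₀ i j ≤ n := fun i j =>
    (Finset.single_le_sum (f := fun j => n₀ i j) (fun _ _ => Nat.zero_le _)
      (Finset.mem_univ j)).trans
      (Finset.single_le_sum (f := fun i => ∑ j, n₀ i j) (fun _ _ => Nat.zero_le _)
        (Finset.mem_univ i))
  refine LinearIndependent.fintype_card_le_finrank (R := F) (b := fun i => x i ^ n) ?_
  rw [Fintype.linearIndependent_iff]
  intro g hg
  by_contra! hne0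
  obtain ⟨i₁, hi₁⟩ := hne0
  obtain ⟨i, -, hi⟩ := Finset.exists_max_image Finset.univ (fun i => w (g i))
    ⟨i₁, Finset.mem_univ _⟩
  have hgi : g i ≠ 0 := fun h0 => by
    have := hi i₁ (Finset.mem_univ _)
    rw [h0, map_zero] at this
    exact absurd (w.pos hi₁) this.not_gt
  -- Maximality for `w` passes to `v i` because `v i` restricts to the class of `w`.
  have hle : ∀ j, v i (algebraMap F K (g j)) ≤ v i (algebraMap F K (g i)) := fun j =>
    ((hw i).le_iff_le).2 (hi j (Finset.mem_univ _))
  have hpos : 0 < v i (algebraMap F K (g i)) := (v i).pos (by simpa using hgi)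
  rw [← Finset.add_sum_erase _ _ (Finset.mem_univ i), add_eq_zero_iff_eq_neg] at hg
  have h1 : v i (g i • x i ^ n) ≤ ∑ j ∈ Finset.univ.erase i, v i (g j • x j ^ n) := by
    rw [hg, (v i).map_neg]
    exact (v i).sum_le _ _
  have hc : (0 : ℝ) < Fintype.card ι := by
    exact_mod_cast Fintype.card_pos_iff.2 ⟨i⟩
  have h2 : ∑ j ∈ Finset.univ.erase i, v i (g j • x j ^ n) ≤
      ∑ j ∈ Finset.univ.erase i, v i (algebraMap F K (g i)) * (Fintype.card ι : ℝ)⁻¹ := by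
    refine Finset.sum_le_sum fun j hj => ?_
    rw [Algebra.smul_def, map_mul, map_pow]
    refine mul_le_mul (hle j) ?_ (pow_nonneg ((v i).nonneg _) _) hpos.le
    rw [← one_div, le_div_iff₀' hc]
    exact (hn₀ i j (Finset.ne_of_mem_erase hj) n (hn i j)).le
  rw [Finset.sum_const, Finset.card_erase_of_mem (Finset.mem_univ i), nsmul_eq_mul] at h2
  have h3 : v i (algebraMap F K (g i)) ≤ v i (g i • x i ^ n) := by
    rw [Algebra.smul_def, map_mul, map_pow]
    exact le_mul_of_one_le_right hpos.le (one_le_pow₀ (hx1 i).le)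
  have h4 : (((Finset.univ : Finset ι).card - 1 : ℕ) : ℝ) < Fintype.card ι := by
    have : 0 < Fintype.card ι := Fintype.card_pos_iff.2 ⟨i⟩
    rw [Finset.card_univ, Nat.cast_lt]
    omega
  have h5 : (((Finset.univ : Finset ι).card - 1 : ℕ) : ℝ) * (v i (algebraMap F K (g i)) *
      (Fintype.card ι : ℝ)⁻¹) < v i (algebraMap F K (g i)) := by
    rw [mul_left_comm]
    refine mul_lt_of_lt_one_right hpos ?_
    rwa [← div_eq_mul_inv, div_lt_one hc]
  linarith

theorem finite_places_of_restrict_isEquiv [FiniteDimensional F K] (w : AbsoluteValue F ℝ) :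
    {q : Place K | ∃ v : {v : AbsoluteValue K ℝ // v.IsNontrivial},
      Quotient.mk (placeSetoid K) v = q ∧ (restrict F v.1).IsEquiv w}.Finite := by
  by_contra hinf
  obtain ⟨t, ht, hcard⟩ := Set.Infinite.exists_subset_card_eq hinf (Module.finrank F K + 1)
  have hrep : ∀ q : t, ∃ v : {v : AbsoluteValue K ℝ // v.IsNontrivial},
      Quotient.mk (placeSetoid K) v = q.1 ∧ (restrict F v.1).IsEquiv w := fun q => ht q.2
  choose v hv hvw using hrep
  have := card_le_finrank_of_restrict_isEquiv (fun q => (v q).1) w (fun q => (v q).2)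
    (fun q q' hqq' h => hqq' (Subtype.ext ((hv q).symm.trans ((Quotient.sound h).trans (hv q')))))
    hvw
  rw [Fintype.card_coe, hcard] at this
  omega

end Fibers

/-! ### Base rings resembling `ℤ`, and centres of absolute values. -/

section Base

/-- A principal ideal domain `A` with field of fractions `F` and an absolute value `w` "at
infinity", behaving like `ℤ` with its usual absolute value. -/
structure IsGlobalBase (A : Type) {F : Type} [CommRing A] [Field F] [Algebra A F]
    (w : AbsoluteValue F ℝ) : Prop where
  nontrivial : w.IsNontrivial
  finite_ball : ∀ C : ℝ, {a : A | w (algebraMap A F a) ≤ C}.Finite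
  le_one_or_isEquiv : ∀ v : AbsoluteValue F ℝ, v.IsNontrivial →
    (∀ a : A, v (algebraMap A F a) ≤ 1) ∨ v.IsEquiv w
  extends_algClosed : ExtendsToAlgClosed w

/-- The prime ideal of a ring attached to an absolute value that is bounded by one on it. -/
def centre {A K : Type*} [CommRing A] [Field K] [Algebra A K] (v : AbsoluteValue K ℝ)
    (h : ∀ a : A, v (algebraMap A K a) ≤ 1) : Ideal A where
  carrier := {a | v (algebraMap A K a) < 1}
  add_mem' {a b} ha hb := by
    simp only [Set.mem_ofPred_eq, map_add] at *
    exact (isNonarchimedean_of_le_one v h _ _).trans_lt (max_lt ha hb)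
  zero_mem' := by simp
  smul_mem' c {a} ha := by
    simp only [Set.mem_ofPred_eq, smul_eq_mul, map_mul] at *
    exact (mul_le_of_le_one_left (v.nonneg _) (h c)).trans_lt ha

theorem mem_centre {A K : Type*} [CommRing A] [Field K] [Algebra A K] {v : AbsoluteValue K ℝ}
    {h : ∀ a : A, v (algebraMap A K a) ≤ 1} {a : A} :
    a ∈ centre v h ↔ v (algebraMap A K a) < 1 := Iff.rfl

theorem centre_isPrime {A K : Type*} [CommRing A] [Field K] [Algebra A K]
    (v : AbsoluteValue K ℝ) (h : ∀ a : A, v (algebraMap A K a) ≤ 1) : (centre v h).IsPrime where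
  ne_top' := (Ideal.ne_top_iff_one _).2 (by simp [mem_centre])
  mem_or_mem' {a b} hab := by
    by_contra! hcon
    simp only [mem_centre, not_lt, map_mul] at *
    exact hab.not_ge (one_le_mul_of_one_le_of_one_le hcon.1 hcon.2)

/-- For a reduced fraction `a / b`, being less than one means that `a` lies in the centre and `b`
does not; a generator of the centre cannot divide both. So the centre decides the open unit ball. -/
theorem isEquiv_of_centre_eq {A F : Type*} [CommRing A] [IsDomain A] [IsPrincipalIdealRing A]
    [Field F] [Algebra A F] [IsFractionRing A F] {v v' : AbsoluteValue F ℝ}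
    (hv : ∀ a : A, v (algebraMap A F a) ≤ 1) (hv' : ∀ a : A, v' (algebraMap A F a) ≤ 1)
    (hnt : v.IsNontrivial) (h : centre v hv = centre v' hv') : v.IsEquiv v' := by
  refine AbsoluteValue.isEquiv_of_lt_one_imp hnt fun x hx => ?_
  obtain ⟨a, b, hab, rfl⟩ := IsFractionRing.exists_reduced_fraction A x
  have hb0 := IsFractionRing.to_map_ne_zero_of_mem_nonZeroDivisors (K := F) b.2
  rw [IsFractionRing.mk'_eq_div, map_div₀] at hx ⊢
  rw [div_lt_one (v.pos hb0)] at hx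
  have ha : a ∈ centre v hv := hx.trans_le (hv _)
  have hb : (b : A) ∉ centre v hv := fun hb => by
    obtain ⟨π, hπ⟩ := IsPrincipalIdealRing.principal (centre v hv)
    have := centre_isPrime v hv
    rw [hπ, Ideal.submodule_span_eq, Ideal.mem_span_singleton] at ha hb
    refine (centre_isPrime v hv).ne_top ?_
    rw [hπ, Ideal.submodule_span_eq, Ideal.span_singleton_eq_top]
    exact hab ha hb
  rw [h] at ha hb
  rw [div_lt_one (v'.pos hb0)]
  exact (mem_centre.1 ha).trans_le (not_lt.1 hb)

end Base

/-! ### Finiteness of `S(𝔭)` and of boxes. -/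

section Arithmetic

variable {A F K M : Type} [CommRing A] [IsDomain A] [IsPrincipalIdealRing A] [Field F] [Field K]
  [CommRing M] [Algebra A F] [IsFractionRing A F] [Algebra F K] [Algebra A K]
  [IsScalarTower A F K] [FiniteDimensional F K] [Algebra M K]

/-- The absolute value `v` of `K` is unbounded on `M`. -/
def IsUnboundedOn (M : Type*) {K : Type*} [CommRing M] [Field K] [Algebra M K]
    (v : AbsoluteValue K ℝ) : Prop :=
  ¬ BddAbove (Set.range fun a : M => v (algebraMap M K a))

/-- `M` is closed under powers, so any bound is a bound by one. -/
theorem le_one_of_not_isUnboundedOn {v : AbsoluteValue K ℝ} (h : ¬ IsUnboundedOn M v) (a : M) :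
    v (algebraMap M K a) ≤ 1 := by
  obtain ⟨C, hC⟩ := not_not.1 h
  by_contra! hlt
  obtain ⟨n, hn⟩ := pow_unbounded_of_one_lt C hlt
  have := hC ⟨a ^ n, rfl⟩
  simp only [map_pow] at this
  linarith

theorem IsUnboundedOn.congr {v v' : AbsoluteValue K ℝ} (h : IsUnboundedOn M v)
    (hvv' : v.IsEquiv v') : IsUnboundedOn M v' := by
  by_contra h'
  exact h ⟨1, by
    rintro _ ⟨a, rfl⟩
    exact hvv'.le_one_iff.2 (le_one_of_not_isUnboundedOn h' a)⟩

/-- Up to powers of `D`, the elements of `M` are integral over `A`. -/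
def IsDenominator (A K M : Type*) [CommRing A] [Field K] [CommRing M] [Algebra A K] [Algebra M K]
    (D : A) : Prop :=
  ∀ a : M, ∃ j : ℕ, IsIntegral A (algebraMap A K D ^ j * algebraMap M K a)

theorem lt_one_of_isUnboundedOn {A K M : Type*} [CommRing A] [Field K] [CommRing M] [Algebra A K]
    [Algebra M K] {D : A} (hD : IsDenominator A K M D)
    {v : AbsoluteValue K ℝ} (hv : ∀ a : A, v (algebraMap A K a) ≤ 1) (hu : IsUnboundedOn M v) :
    v (algebraMap A K D) < 1 := by
  refine lt_of_le_of_ne (hv D) fun h1 => hu ⟨1, ?_⟩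
  rintro _ ⟨a, rfl⟩
  obtain ⟨j, hj⟩ := hD a
  have := le_one_of_isIntegral v hv hj
  rwa [map_mul, map_pow, h1, one_pow, one_mul] at this

theorem restrict_isNontrivial {v : AbsoluteValue K ℝ} (hv : v.IsNontrivial) :
    (restrict F v).IsNontrivial := by
  by_contra h
  rw [AbsoluteValue.not_isNontrivial_iff] at h
  obtain ⟨x, hx⟩ := hv.exists_abv_gt_one
  have hle : ∀ a : F, v (algebraMap F K a) ≤ 1 := fun a => by
    rcases eq_or_ne a 0 with rfl | ha
    · simp
    · exact (h a ha).le
  exact hx.not_ge (le_one_of_isIntegral v hle (Algebra.IsIntegral.isIntegral x))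

theorem restrict_algebraMap {A F K : Type*} [CommRing A] [Field F] [Field K] [Algebra A F]
    [Algebra F K] [Algebra A K] [IsScalarTower A F K] (v : AbsoluteValue K ℝ) (a : A) :
    restrict F v (algebraMap A F a) = v (algebraMap A K a) := by
  rw [restrict_apply, ← IsScalarTower.algebraMap_apply]

/-- A place unbounded on `M` either restricts to the class of `w` or is at most one on `A`. In the
second case `v D < 1`, so its centre is one of the finitely many primes dividing `D`; the centre
determines the restriction to `F`, which has finitely many extensions to `K`. -/
theorem finite_unbounded_places {w : AbsoluteValue F ℝ} (hw : IsGlobalBase A w) {D : A}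
    (hD0 : D ≠ 0) (hD : IsDenominator A K M D) :
    {q : Place K | ∃ v : {v : AbsoluteValue K ℝ // v.IsNontrivial},
      Quotient.mk (placeSetoid K) v = q ∧ IsUnboundedOn M v.1}.Finite := by
  have hI : Ideal.span {D} ≠ ⊥ := by simpa using hD0
  let T (P : IsDedekindDomain.HeightOneSpectrum A) : Set (Place K) :=
    {q | ∃ v : {v : AbsoluteValue K ℝ // v.IsNontrivial}, Quotient.mk (placeSetoid K) v = q ∧
      ∃ h : ∀ a : A, restrict F v.1 (algebraMap A F a) ≤ 1, centre (restrict F v.1) h = P.asIdeal}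
  have hT : ∀ P, (T P).Finite := fun P => by
    rcases (T P).eq_empty_or_nonempty with h | ⟨q₀, v₀, -, h₀, hP₀⟩
    · rw [h]; exact Set.finite_empty
    · refine (finite_places_of_restrict_isEquiv (restrict F v₀.1)).subset ?_
      rintro q ⟨v, hvq, h, hP⟩
      exact ⟨v, hvq, isEquiv_of_centre_eq h h₀ (restrict_isNontrivial v.2) (hP.trans hP₀.symm)⟩
  refine ((finite_places_of_restrict_isEquiv w).union
    ((Ideal.finite_factors hI).biUnion fun P _ => hT P)).subset ?_
  rintro q ⟨v, hvq, hu⟩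
  rcases hw.le_one_or_isEquiv _ (restrict_isNontrivial v.2) with h | h
  · right
    have hDv : D ∈ centre (restrict F v.1) h := by
      rw [mem_centre, restrict_algebraMap]
      exact lt_one_of_isUnboundedOn hD (fun a => restrict_algebraMap (F := F) v.1 a ▸ h a) hu
    let P : IsDedekindDomain.HeightOneSpectrum A :=
      ⟨centre (restrict F v.1) h, centre_isPrime _ h, fun h0 => hD0 (by
        rw [h0] at hDv; simpa using hDv)⟩
    refine Set.mem_biUnion (x := P) ?_ ⟨v, hvq, h, rfl⟩
    exact Ideal.dvd_iff_le.2 ((Ideal.span_singleton_le_iff_mem _).2 hDv)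
  · exact Or.inl ⟨v, hvq, h⟩

/-- The elements of `M` that are bounded by `t` at the places that are unbounded on `M`. -/
def upperBox (M : Type*) {K : Type*} [CommRing M] [Field K] [Algebra M K]
    (N : Place K → K → ℝ) (t : ℝ) : Set M :=
  {a | ∀ v : {v : AbsoluteValue K ℝ // v.IsNontrivial}, IsUnboundedOn M v.1 →
    N (Quotient.mk (placeSetoid K) v) (algebraMap M K a) ≤ t}

theorem exists_bound_upperBox {N : Place K → K → ℝ} (hN : IsNormalization N) (t : ℝ)
    {v : AbsoluteValue K ℝ} (hv : v.IsNontrivial) :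
    ∃ C : ℝ, ∀ a ∈ upperBox M N t, v (algebraMap M K a) ≤ C := by
  by_cases hu : IsUnboundedOn M v
  · obtain ⟨v', hv', c, hc, hNc⟩ := hN (Quotient.mk (placeSetoid K) ⟨v, hv⟩)
    have heq : v'.1.IsEquiv v := Quotient.exact hv'
    obtain ⟨r, hr, hrv⟩ := AbsoluteValue.isEquiv_iff_exists_rpow_eq.1 heq
    -- The exponent `c` undoes the normalisation and `r` compares the two representatives; `|t|` is
    -- there because `t` may be negative.
    refine ⟨(|t| ^ c⁻¹) ^ r, fun a ha => ?_⟩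
    have h1 := ha ⟨v, hv⟩ hu
    rw [hNc] at h1
    rw [← hrv]
    refine Real.rpow_le_rpow (v'.1.nonneg _) ?_ hr.le
    rw [Real.le_rpow_inv_iff_of_pos (v'.1.nonneg _) (abs_nonneg _) hc]
    exact h1.trans (le_abs_self t)
  · exact ⟨1, fun a _ => le_one_of_not_isUnboundedOn hu a⟩

/-- At a place at most one on `A` but unbounded on `M`, `v D < 1`, so a high power of `D` absorbs
the bound on the box. Finitely many such places share one exponent. -/
theorem exists_pow_mul_isIntegral {w : AbsoluteValue F ℝ} (hw : IsGlobalBase A w) {D : A}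
    (hD0 : D ≠ 0) (hD : IsDenominator A K M D) {N : Place K → K → ℝ} (hN : IsNormalization N)
    (t : ℝ) : ∃ n : ℕ, ∀ a ∈ upperBox M N t,
      IsIntegral A (algebraMap A K D ^ n * algebraMap M K a) := by
  have hev : ∀ q : Place K, ∀ᶠ n : ℕ in atTop, ∀ a ∈ upperBox M N t,
      ∀ v : {v : AbsoluteValue K ℝ // v.IsNontrivial}, Quotient.mk (placeSetoid K) v = q →
      (∀ a : A, v.1 (algebraMap A K a) ≤ 1) → IsUnboundedOn M v.1 →
      v.1 (algebraMap A K D ^ n * algebraMap M K a) ≤ 1 := by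
    intro q
    obtain ⟨v₀, rfl⟩ := Quotient.exists_rep q
    obtain ⟨C, hC⟩ := exists_bound_upperBox (M := M) hN t v₀.2
    by_cases h₀ : (∀ a : A, v₀.1 (algebraMap A K a) ≤ 1) ∧ IsUnboundedOn M v₀.1
    · have hlim := (tendsto_pow_atTop_nhds_zero_of_lt_one (v₀.1.nonneg _)
        (lt_one_of_isUnboundedOn hD h₀.1 h₀.2)).mul_const C
      rw [zero_mul] at hlim
      filter_upwards [hlim.eventually (gt_mem_nhds one_pos)] with n hn a ha v hv _ _
      have hvv₀ : v.1.IsEquiv v₀.1 := Quotient.exact hv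
      rw [hvv₀.le_one_iff, map_mul, map_pow]
      exact (mul_le_mul_of_nonneg_left (hC a ha) (pow_nonneg (v₀.1.nonneg _) _)).trans hn.le
    · refine Eventually.of_forall fun n a ha v hv h1 h2 => absurd ?_ h₀
      have hvv₀ : v.1.IsEquiv v₀.1 := Quotient.exact hv
      exact ⟨fun a => hvv₀.le_one_iff.1 (h1 a), h2.congr hvv₀⟩
  obtain ⟨n, hn⟩ := ((eventually_all_finite (finite_unbounded_places hw hD0 hD)).2
    fun q _ => hev q).exists
  refine ⟨n, fun a ha => isIntegral_of_forall_le_one (F := F) _ fun v hv => ?_⟩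
  by_cases hnt : v.IsNontrivial
  · by_cases hu : IsUnboundedOn M v
    · exact hn _ ⟨⟨v, hnt⟩, rfl, hu⟩ a ha ⟨v, hnt⟩ rfl hv hu
    · rw [map_mul, map_pow]
      exact mul_le_one₀ (pow_le_one₀ (v.nonneg _) (hv D)) (v.nonneg _)
        (le_one_of_not_isUnboundedOn hu a)
  -- The integrality criterion also quantifies over the trivial absolute value.
  · rw [AbsoluteValue.not_isNontrivial_iff] at hnt
    rcases eq_or_ne (algebraMap A K D ^ n * algebraMap M K a) 0 with h | h
    · simp [h]
    · exact (hnt _ h).le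

/-- A Northcott argument: after clearing denominators the elements are integral with bounded
conjugates, so their minimal polynomials have bounded degree and coefficients in a finite subset of
`A`. -/
theorem finite_upperBox {w : AbsoluteValue F ℝ} (hw : IsGlobalBase A w) {D : A}
    (hD0 : D ≠ 0) (hD : IsDenominator A K M D) (hinj : Function.Injective (algebraMap M K))
    {N : Place K → K → ℝ} (hN : IsNormalization N) (t : ℝ) : (upperBox M N t).Finite := by
  classical
  obtain ⟨n, hn⟩ := exists_pow_mul_isIntegral (M := M) hw hD0 hD hN t
  obtain ⟨L, _, _, f, hf⟩ := hw.extends_algClosed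
  let := f.toAlgebra
  have hσ : ∀ σ : K →ₐ[F] L, ∃ C : ℝ, ∀ a ∈ upperBox M N t,
      ‖σ (algebraMap A K D ^ n * algebraMap M K a)‖ ≤ C := fun σ => by
    have hnt : ((normAbs L).comp (f := σ.toRingHom) σ.toRingHom.injective).IsNontrivial := by
      obtain ⟨x, hx0, hx⟩ := hw.nontrivial
      refine ⟨algebraMap F K x, by simpa using hx0, ?_⟩
      change ‖σ (algebraMap F K x)‖ ≠ 1
      rw [σ.commutes]
      exact (hf x).trans_ne hx
    obtain ⟨C, hC⟩ := exists_bound_upperBox (M := M) hN t hnt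
    refine ⟨‖σ (algebraMap A K D ^ n)‖ * C, fun a ha => ?_⟩
    rw [map_mul, norm_mul]
    exact mul_le_mul_of_nonneg_left (hC a ha) (norm_nonneg _)
  choose C hC using hσ
  have : Finite (K →ₐ[F] L) := inferInstance
  obtain ⟨B, hB⟩ := (Set.finite_range C).bddAbove
  have hDK : algebraMap A K D ≠ 0 := by
    rw [IsScalarTower.algebraMap_apply A F K]
    simpa using hD0
  refine Set.Finite.of_finite_image (f := fun a => algebraMap A K D ^ n * algebraMap M K a) ?_
    (fun a _ b _ hab => hinj (mul_left_cancel₀ (pow_ne_zero n hDK) hab))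
  refine (Polynomial.bUnion_roots_finite (algebraMap A K) (Module.finrank F K)
    -- This is the coefficient bound for a polynomial of degree at most `[K : F]` with roots of norm
    -- at most `B`.
    (hw.finite_ball (max B 1 ^ (Module.finrank F K) *
      (Module.finrank F K).choose (Module.finrank F K / 2)))).subset ?_
  rintro _ ⟨a, ha, rfl⟩
  simp only
  set b := algebraMap A K D ^ n * algebraMap M K a with hb
  have hbi : IsIntegral A b := hn a ha
  have hbF : IsIntegral F b := Algebra.IsIntegral.isIntegral b
  have hmin : minpoly F b = (minpoly A b).map (algebraMap A F) :=
    minpoly.isIntegrallyClosed_eq_field_fractions' F hbi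
  have hdeg : (minpoly F b).natDegree ≤ Module.finrank F K := minpoly.natDegree_le b
  refine Set.mem_biUnion (x := minpoly A b) ⟨?_, fun i => ?_⟩ ?_
  · rwa [hmin, (minpoly.monic hbi).natDegree_map] at hdeg
  · have := Polynomial.coeff_bdd_of_roots_le (B := B) f (minpoly.monic hbF)
      (IsAlgClosed.splits _) hdeg (fun z hz => by
        have hz' : z ∈ (minpoly F b).rootSet L := by
          rw [Polynomial.rootSet, Polynomial.aroots, Finset.mem_coe, Multiset.mem_toFinset]
          exact hz
        rw [← Algebra.IsAlgebraic.range_eval_eq_rootSet_minpoly] at hz'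
        obtain ⟨σ, rfl⟩ := hz'
        exact (hC σ a ha).trans (hB ⟨σ, rfl⟩)) i
    rw [Polynomial.coeff_map, hf, hmin, Polynomial.coeff_map] at this
    exact this
  · rw [Finset.mem_coe, Multiset.mem_toFinset, Polynomial.mem_roots
      ((minpoly.monic hbi).map _).ne_zero, Polynomial.IsRoot, Polynomial.eval_map_algebraMap]
    exact minpoly.aeval A b

end Arithmetic

/-! ### The fraction field as a finite extension, and common denominators. -/

section FractionField

/-- Otherwise some prime `q` containing `m` misses the nonzero elements of `A`. It is maximal by
dimension one, so the field `M ⧸ q` is finite over the Jacobson ring `A`, which embeds in it; then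
`A` would be a field. -/
theorem exists_dvd_algebraMap {A M : Type*} [CommRing A] [IsDomain A] [IsJacobsonRing A]
    [CommRing M] [IsDomain M] [Algebra A M] [Algebra.FiniteType A M] [Ring.KrullDimLE 1 M]
    (hA : ¬ IsField A) {m : M} (hm : m ≠ 0) :
    ∃ a : A, a ≠ 0 ∧ m ∣ algebraMap A M a := by
  by_contra! hcon
  obtain ⟨q, hq, hmq, hdisj⟩ := Ideal.exists_le_prime_disjoint (Ideal.span {m})
    (Algebra.algebraMapSubmonoid M (nonZeroDivisors A)) (by
      rw [Set.disjoint_left]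
      rintro _ hx ⟨a, ha, rfl⟩
      exact hcon a (nonZeroDivisors.ne_zero ha) (Ideal.mem_span_singleton.1 hx))
  have hqm : q.IsMaximal := Ideal.isMaximal_of_isPrime_of_ne_bot q fun h => by
    rw [h] at hmq
    exact hm (by simpa using hmq (Ideal.mem_span_singleton_self m))
  let := Ideal.Quotient.field q
  have := finite_of_finite_type_of_isJacobsonRing A (M ⧸ q)
  refine hA (isField_of_isIntegral_of_isField (R := A) (S := M ⧸ q) ?_ (Field.toIsField _))
  rw [injective_iff_map_eq_zero]
  intro a ha
  by_contra ha0
  have hmem : algebraMap A M a ∈ q := Ideal.Quotient.eq_zero_iff_mem.1 ha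
  exact Set.disjoint_left.1 hdisj hmem ⟨a, mem_nonZeroDivisors_of_ne_zero ha0, rfl⟩

variable {A F K M : Type*} [CommRing A] [IsDomain A] [Field F] [Field K]
  [CommRing M] [Algebra A F] [IsFractionRing A F] [Algebra F K] [Algebra A K]
  [IsScalarTower A F K] [Algebra A M] [Algebra M K] [IsScalarTower A M K]
  [Algebra.FiniteType A M]

/-- Every denominator divides a nonzero element of `A`, so `K` is generated as an `F`-algebra by
generators of `M`; Zariski's lemma concludes. -/
theorem finiteDimensional_fractionField [IsDomain M] [IsFractionRing M K]
    [IsJacobsonRing A] [Ring.KrullDimLE 1 M]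
    (hA : ¬ IsField A) : FiniteDimensional F K := by
  obtain ⟨s, hs⟩ := Algebra.FiniteType.out (R := A) (A := M)
  let E : Subalgebra F K := Algebra.adjoin F (algebraMap M K '' s)
  have hM : ∀ m : M, algebraMap M K m ∈ E := fun m => by
    have hm : m ∈ Algebra.adjoin A (s : Set M) := hs ▸ Algebra.mem_top
    induction hm using Algebra.adjoin_induction with
    | mem x hx => exact Algebra.subset_adjoin ⟨x, hx, rfl⟩
    | algebraMap r =>
      rw [← IsScalarTower.algebraMap_apply, IsScalarTower.algebraMap_apply A F K]
      exact E.algebraMap_mem _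
    | add x y _ _ hx hy => rw [map_add]; exact add_mem hx hy
    | mul x y _ _ hx hy => rw [map_mul]; exact mul_mem hx hy
  have htop : E = ⊤ := by
    refine eq_top_iff.2 fun x _ => ?_
    obtain ⟨m, n, hn, rfl⟩ := IsFractionRing.div_surjective M x
    obtain ⟨a, ha, c, hc⟩ := exists_dvd_algebraMap hA (nonZeroDivisors.ne_zero hn)
    have hcK : algebraMap F K (algebraMap A F a) = algebraMap M K n * algebraMap M K c := by
      rw [← IsScalarTower.algebraMap_apply, IsScalarTower.algebraMap_apply A M K, hc, map_mul]
    have ha0 : algebraMap A F a ≠ 0 := by simpa using ha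
    have hnK : algebraMap M K n ≠ 0 := IsFractionRing.to_map_ne_zero_of_mem_nonZeroDivisors hn
    have haK : algebraMap F K (algebraMap A F a) ≠ 0 := by simpa using ha
    have : algebraMap M K m / algebraMap M K n =
        algebraMap M K m * algebraMap M K c * algebraMap F K (algebraMap A F a)⁻¹ := by
      rw [map_inv₀, ← div_eq_mul_inv, div_eq_div_iff hnK haK, hcK]
      ring
    rw [this]
    exact mul_mem (mul_mem (hM m) (hM c)) (E.algebraMap_mem _)
  classical
  have : Algebra.FiniteType F K := ⟨⟨s.image (algebraMap M K), by
    rw [Finset.coe_image]; exact htop⟩⟩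
  exact finite_of_finite_type_of_isJacobsonRing F K

/-- `D` is the product of integral multipliers of a finite generating set; the property survives
sums and products by adding exponents. -/
theorem exists_isDenominator [Algebra.IsAlgebraic F K] :
    ∃ D : A, D ≠ 0 ∧ IsDenominator A K M D := by
  classical
  obtain ⟨s, hs⟩ := Algebra.FiniteType.out (R := A) (A := M)
  have hint : ∀ m : M, ∃ y : A, y ≠ 0 ∧ IsIntegral A (y • algebraMap M K m) := fun m => by
    have halg : IsAlgebraic A (algebraMap M K m) :=
      (IsFractionRing.isAlgebraic_iff A F K).2 (Algebra.IsAlgebraic.isAlgebraic _)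
    obtain ⟨y, hy, h⟩ := halg.exists_integral_multiple
    exact ⟨y, hy, h⟩
  choose y hy0 hy using hint
  refine ⟨∏ g ∈ s, y g, Finset.prod_ne_zero_iff.2 fun g _ => hy0 g, fun m => ?_⟩
  set D := ∏ g ∈ s, y g with hD
  have hDi : ∀ j : ℕ, IsIntegral A (algebraMap A K D ^ j) := fun j => isIntegral_algebraMap.pow j
  have hm : m ∈ Algebra.adjoin A (s : Set M) := hs ▸ Algebra.mem_top
  induction hm using Algebra.adjoin_induction with
  | mem x hx =>
    refine ⟨1, ?_⟩
    have : algebraMap A K D ^ 1 * algebraMap M K x =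
        algebraMap A K (∏ g ∈ s.erase x, y g) * (y x • algebraMap M K x) := by
      rw [hD, ← Finset.mul_prod_erase s y hx, pow_one, map_mul, Algebra.smul_def]
      ring
    rw [this]
    exact isIntegral_algebraMap.mul (hy x)
  | algebraMap r =>
    refine ⟨0, ?_⟩
    rw [pow_zero, one_mul, ← IsScalarTower.algebraMap_apply]
    exact isIntegral_algebraMap
  | add a b _ _ ha hb =>
    obtain ⟨i, hi⟩ := ha
    obtain ⟨j, hj⟩ := hb
    refine ⟨i + j, ?_⟩
    have : algebraMap A K D ^ (i + j) * algebraMap M K (a + b) =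
        algebraMap A K D ^ j * (algebraMap A K D ^ i * algebraMap M K a) +
        algebraMap A K D ^ i * (algebraMap A K D ^ j * algebraMap M K b) := by
      rw [map_add]; ring
    rw [this]
    exact ((hDi j).mul hi).add ((hDi i).mul hj)
  | mul a b _ _ ha hb =>
    obtain ⟨i, hi⟩ := ha
    obtain ⟨j, hj⟩ := hb
    refine ⟨i + j, ?_⟩
    have : algebraMap A K D ^ (i + j) * algebraMap M K (a * b) =
        (algebraMap A K D ^ i * algebraMap M K a) *
        (algebraMap A K D ^ j * algebraMap M K b) := by
      rw [map_mul]; ring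
    rw [this]
    exact hi.mul hj

end FractionField

/-! ### The two base rings: `ℤ` and `k[X]` with `k` finite. -/

section Bases

theorem isGlobalBase_int : IsGlobalBase ℤ (F := ℚ) Rat.AbsoluteValue.real where
  nontrivial := ⟨2, by norm_num, by simp⟩
  finite_ball C := by
    refine (Set.finite_Icc (-⌈C⌉) ⌈C⌉).subset fun a ha => ?_
    have h : |(a : ℝ)| ≤ C := by simpa using ha
    have h' := abs_le.1 (h.trans (Int.le_ceil C))
    exact ⟨by exact_mod_cast h'.1, by exact_mod_cast h'.2⟩
  le_one_or_isEquiv v hv := by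
    rcases Rat.AbsoluteValue.equiv_real_or_padic v hv with h | ⟨p, ⟨hp, h⟩, -⟩
    · exact Or.inr h
    · refine Or.inl fun a => (AbsoluteValue.IsEquiv.le_one_iff h).2 ?_
      simpa using Rat.AbsoluteValue.padic_le_one p a
  extends_algClosed := ⟨ℂ, inferInstance, inferInstance, Rat.castHom ℂ, fun x => by
    simp⟩

/-- The absolute value `2 ^ deg` on rational functions. -/
noncomputable def degreeAbs (k : Type*) [Field k] : AbsoluteValue (RatFunc k) ℝ := by
  classical
  exact
  { toFun := fun x => if x = 0 then 0 else (2 : ℝ) ^ x.intDegree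
    map_mul' := fun x y => by
      by_cases hx : x = 0
      · simp [hx]
      by_cases hy : y = 0
      · simp [hy]
      simp [hx, hy, RatFunc.intDegree_mul, zpow_add₀]
    nonneg' := fun x => by split_ifs <;> positivity
    eq_zero' := fun x => by
      split_ifs with h
      · simp [h]
      · simp only [h, iff_false]; positivity
    add_le' := fun x y => by
      by_cases hx : x = 0
      · simp [hx]
      by_cases hy : y = 0
      · simp [hy]
      by_cases hxy : x + y = 0
      · simp only [hxy, if_true, hx, hy, if_false]; positivity
      simp only [hx, hy, hxy, if_false]
      have h := RatFunc.intDegree_add_le hy hxy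
      rcases le_max_iff.1 h with h | h
      · exact (zpow_le_zpow_right₀ one_le_two h).trans (le_add_of_nonneg_right (by positivity))
      · exact (zpow_le_zpow_right₀ one_le_two h).trans (le_add_of_nonneg_left (by positivity)) }

theorem degreeAbs_apply {k : Type*} [Field k] {x : RatFunc k} (hx : x ≠ 0) :
    degreeAbs k x = (2 : ℝ) ^ x.intDegree := by
  simp [degreeAbs, hx]

open Polynomial in
theorem degreeAbs_algebraMap {k : Type*} [Field k] {f : k[X]} (hf : f ≠ 0) :
    degreeAbs k (algebraMap k[X] (RatFunc k) f) = (2 : ℝ) ^ f.natDegree := by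
  rw [degreeAbs_apply (by simpa using hf), RatFunc.intDegree_polynomial, zpow_natCast]

theorem degreeAbs_algebraMap_le_one {k : Type*} [Field k] (c : k) :
    degreeAbs k (algebraMap k (RatFunc k) c) ≤ 1 := by
  rcases eq_or_ne c 0 with rfl | h
  · simp
  · have := degreeAbs_algebraMap (f := Polynomial.C c) (by simpa using h)
    rw [Polynomial.natDegree_C, pow_zero, RatFunc.algebraMap_C] at this
    exact this.le

theorem apply_algebraMap_eq_one_of_finite {k K : Type*} [Field k] [Finite k] [Field K] [Algebra k K]
    (v : AbsoluteValue K ℝ) {c : k} (hc : c ≠ 0) : v (algebraMap k K c) = 1 := by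
  obtain ⟨n, hn, h⟩ := isOfFinOrder_iff_pow_eq_one.1 (isOfFinOrder_of_finite (Units.mk0 c hc))
  have h' : c ^ n = 1 := by simpa using congrArg Units.val h
  rw [← pow_eq_one_iff_of_nonneg (v.nonneg _) hn.ne', ← map_pow, ← map_pow, h', map_one, map_one]

theorem apply_algebraMap_le_one_of_finite {k K : Type*} [Field k] [Finite k] [Field K] [Algebra k K]
    (v : AbsoluteValue K ℝ) (c : k) : v (algebraMap k K c) ≤ 1 := by
  rcases eq_or_ne c 0 with rfl | h
  · simp
  · exact (apply_algebraMap_eq_one_of_finite v h).le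

section Polynomial

open Polynomial

variable {k : Type*} [Field k] [Finite k] (v : AbsoluteValue (RatFunc k) ℝ)

theorem apply_polynomial_le {B : ℝ} {f : k[X]} (hB : ∀ i ≤ f.natDegree, v RatFunc.X ^ i ≤ B) :
    v (algebraMap k[X] (RatFunc k) f) ≤ B := by
  have hna : IsNonarchimedean v := isNonarchimedean_of_le_one v
    (apply_algebraMap_le_one_of_finite (k := k) v)
  have hne : (Finset.range (f.natDegree + 1)).Nonempty := by simp
  have h := hna.apply_sum_le_sup hne
    (l := fun i => algebraMap k[X] (RatFunc k) (C (f.coeff i) * X ^ i))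
  rw [← map_sum, ← f.as_sum_range_C_mul_X_pow] at h
  refine h.trans (Finset.sup'_le _ _ fun i hi => ?_)
  rw [map_mul, map_pow, map_mul, map_pow, RatFunc.algebraMap_C, RatFunc.algebraMap_X]
  exact (mul_le_of_le_one_left (pow_nonneg (v.nonneg _) _)
    (apply_algebraMap_le_one_of_finite v (f.coeff i))).trans
    (hB i (Nat.lt_succ_iff.1 (Finset.mem_range.1 hi)))

/-- Nonzero constants are roots of unity, so have value one and `v` is nonarchimedean; the leading
term then dominates. -/
theorem apply_polynomial_of_one_lt (hX : 1 < v RatFunc.X) {f : k[X]} (hf : f ≠ 0) :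
    v (algebraMap k[X] (RatFunc k) f) = v RatFunc.X ^ f.natDegree := by
  have hna : IsNonarchimedean v := isNonarchimedean_of_le_one v
    (apply_algebraMap_le_one_of_finite (k := k) v)
  have hlead : v (algebraMap k[X] (RatFunc k) (C f.leadingCoeff * X ^ f.natDegree)) =
      v RatFunc.X ^ f.natDegree := by
    rw [map_mul, map_pow, map_mul, map_pow, RatFunc.algebraMap_C, RatFunc.algebraMap_X]
    have := apply_algebraMap_eq_one_of_finite (K := RatFunc k) v (leadingCoeff_ne_zero.2 hf)
    rw [show RatFunc.C f.leadingCoeff = algebraMap k (RatFunc k) f.leadingCoeff from rfl, this,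
      one_mul]
  rw [← hlead]
  conv_lhs => rw [← f.eraseLead_add_C_mul_X_pow, map_add, add_comm]
  refine hna.add_eq_left_of_lt ?_
  rw [hlead]
  rcases Nat.eq_zero_or_pos f.natDegree with h0 | h0
  · rw [eq_C_of_natDegree_eq_zero h0]
    simp
  · refine (apply_polynomial_le v (B := v RatFunc.X ^ (f.natDegree - 1)) fun i hi => ?_).trans_lt
      (pow_lt_pow_right₀ hX (by omega))
    exact pow_le_pow_right₀ hX.le (hi.trans (eraseLead_natDegree_le f))

theorem isEquiv_degreeAbs_of_one_lt (hX : 1 < v RatFunc.X) : v.IsEquiv (degreeAbs k) := by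
  refine AbsoluteValue.isEquiv_of_lt_one_imp ⟨RatFunc.X, RatFunc.X_ne_zero, hX.ne'⟩ fun x hx => ?_
  obtain ⟨f, g, hg, rfl⟩ := IsFractionRing.div_surjective k[X] x
  have hg0 := nonZeroDivisors.ne_zero hg
  rcases eq_or_ne f 0 with rfl | hf0
  · simp
  · have hgp : 0 < v RatFunc.X ^ g.natDegree := by positivity
    rw [map_div₀, apply_polynomial_of_one_lt v hX hf0, apply_polynomial_of_one_lt v hX hg0,
      div_lt_one hgp, pow_lt_pow_iff_right₀ hX] at hx
    rw [map_div₀, degreeAbs_algebraMap hf0, degreeAbs_algebraMap hg0, div_lt_one (by positivity),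
      pow_lt_pow_iff_right₀ one_lt_two]
    exact hx

theorem degreeAbs_isNontrivial (k : Type*) [Field k] : (degreeAbs k).IsNontrivial := by
  refine ⟨RatFunc.X, RatFunc.X_ne_zero, ?_⟩
  rw [← RatFunc.algebraMap_X, degreeAbs_algebraMap X_ne_zero, natDegree_X]
  norm_num

theorem isGlobalBase_polynomial (k : Type) [Field k] [Finite k] :
    IsGlobalBase k[X] (degreeAbs k) where
  nontrivial := degreeAbs_isNontrivial k
  finite_ball C := by
    obtain ⟨n, hn⟩ := pow_unbounded_of_one_lt C (one_lt_two (α := ℝ))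
    have hfin : Finite (degreeLT k n) := Finite.of_equiv _ (degreeLTEquiv k n).toEquiv.symm
    refine (Set.toFinite (degreeLT k n : Set k[X])).subset fun f hf => ?_
    rw [SetLike.mem_coe, mem_degreeLT]
    rcases eq_or_ne f 0 with rfl | h0
    · simp [bot_lt_iff_ne_bot]
    · rw [Set.mem_ofPred_eq, degreeAbs_algebraMap h0] at hf
      rw [degree_eq_natDegree h0]
      exact_mod_cast (pow_lt_pow_iff_right₀ (one_lt_two (α := ℝ))).1 (hf.trans_lt hn)
  le_one_or_isEquiv v hv := by
    rcases le_or_gt (v RatFunc.X) 1 with h | h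
    · exact Or.inl fun f => apply_polynomial_le v fun i _ => pow_le_one₀ (v.nonneg _) h
    · exact Or.inr (isEquiv_degreeAbs_of_one_lt v h)
  extends_algClosed := by
    obtain ⟨L, h1, h2, f, hf, -⟩ := extendsToAlgClosed_of_isNonarchimedean (degreeAbs k)
      (isNonarchimedean_of_le_one _ (degreeAbs_algebraMap_le_one (k := k))) (degreeAbs_isNontrivial k)
    exact ⟨L, h1, h2, f, hf⟩

end Polynomial

end Bases

/-! ### Choice of base ring by characteristic. -/

section Global

theorem isJacobsonRing_int : IsJacobsonRing ℤ := by
  refine isJacobsonRing_iff_prime_eq.2 fun P hP => ?_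
  by_cases h0 : P = ⊥
  · refine le_antisymm (fun x hx => ?_) Ideal.le_jacobson
    rw [h0, Ideal.mem_jacobson_bot] at hx
    rw [h0, Ideal.mem_bot]
    -- Membership in the Jacobson radical of zero makes `x * x + 1` a unit, so `x = 0`.
    rcases Int.isUnit_iff.1 (hx x) with h | h <;> nlinarith
  · have := hP.isMaximal h0
    exact Ideal.jacobson_eq_self_of_isMaximal

theorem finite_places_and_boxes {A F M : Type} [CommRing A] [IsDomain A] [IsPrincipalIdealRing A]
    [IsJacobsonRing A] [Field F] [Algebra A F] [IsFractionRing A F] (hA : ¬ IsField A)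
    {w : AbsoluteValue F ℝ} (hw : IsGlobalBase A w) [CommRing M] [IsDomain M]
    [Ring.KrullDimLE 1 M] [Algebra A M] [Algebra.FiniteType A M]
    (hinj : Function.Injective (algebraMap A M)) :
    {q : Place (FractionRing M) |
      ∃ v : {v : AbsoluteValue (FractionRing M) ℝ // v.IsNontrivial},
        Quotient.mk (placeSetoid _) v = q ∧ IsUnboundedOn M v.1}.Finite ∧
    ∀ N : Place (FractionRing M) → FractionRing M → ℝ, IsNormalization N →
      ∀ t : ℝ, (upperBox M N t).Finite := by
  have hAK : Function.Injective (algebraMap A (FractionRing M)) := by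
    rw [IsScalarTower.algebraMap_eq A M (FractionRing M), RingHom.coe_comp]
    exact (IsFractionRing.injective M (FractionRing M)).comp hinj
  let : Algebra F (FractionRing M) := (IsFractionRing.lift hAK).toAlgebra
  have : IsScalarTower A F (FractionRing M) :=
    IsScalarTower.of_algebraMap_eq fun a => (IsFractionRing.lift_algebraMap hAK a).symm
  have : FiniteDimensional F (FractionRing M) :=
    finiteDimensional_fractionField (A := A) (M := M) hA
  obtain ⟨D, hD0, hD⟩ := exists_isDenominator (A := A) (F := F) (K := FractionRing M) (M := M)
  exact ⟨finite_unbounded_places hw hD0 hD, fun N hN t =>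
    finite_upperBox hw hD0 hD (IsFractionRing.injective M (FractionRing M)) hN t⟩

theorem finite_places_and_boxes_of_finiteType {M : Type} [CommRing M] [IsDomain M]
    [Ring.KrullDimLE 1 M] [Algebra.FiniteType ℤ M] (hM : ¬ IsField M) :
    {q : Place (FractionRing M) |
      ∃ v : {v : AbsoluteValue (FractionRing M) ℝ // v.IsNontrivial},
        Quotient.mk (placeSetoid _) v = q ∧ IsUnboundedOn M v.1}.Finite ∧
    ∀ N : Place (FractionRing M) → FractionRing M → ℝ, IsNormalization N →
      ∀ t : ℝ, (upperBox M N t).Finite := by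
  obtain ⟨p, hp⟩ := CharP.exists M
  rcases CharP.char_is_prime_or_zero M p with hpp | rfl
  · have : Fact p.Prime := ⟨hpp⟩
    let : Algebra (ZMod p) M := ZMod.algebra M p
    -- A domain algebraic over `𝔽_p` is a field, so `M` contains a transcendental `t`.
    have hnalg : ¬ Algebra.IsAlgebraic (ZMod p) M := fun h =>
      hM (isField_of_isIntegral_of_isField' (R := ZMod p) (Field.toIsField _))
    rw [Algebra.isAlgebraic_def] at hnalg
    push Not at hnalg
    obtain ⟨t, ht⟩ := hnalg
    let : Algebra (Polynomial (ZMod p)) M := (Polynomial.aeval t).toAlgebra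
    have : IsScalarTower (ZMod p) (Polynomial (ZMod p)) M :=
      IsScalarTower.of_algebraMap_eq fun c => ((Polynomial.aeval t).commutes c).symm
    have : Algebra.FiniteType (Polynomial (ZMod p)) M :=
      Algebra.FiniteType.of_restrictScalars_finiteType ℤ _ M
    exact finite_places_and_boxes (Polynomial.not_isField _) (isGlobalBase_polynomial (ZMod p))
      (transcendental_iff_injective.1 ht)
  · have : CharZero M := CharP.charP_to_charZero M
    have := isJacobsonRing_int
    exact finite_places_and_boxes Int.not_isField isGlobalBase_int
      (by simpa using Int.cast_injective)

end Global

/-! ### Linear growth from finite sublevel sets. -/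

section Rate

theorem vecNorm_le {d : ℕ} (n : Fin d → ℤ) :
    vecNorm n ≤ d * ‖fun i => (n i : ℝ)‖ := by
  have h : ∀ i, (n i : ℝ) ^ 2 ≤ ‖fun i => (n i : ℝ)‖ ^ 2 := fun i => by
    rw [← sq_abs]
    exact pow_le_pow_left₀ (abs_nonneg _) (norm_le_pi_norm (fun i => (n i : ℝ)) i) 2
  refine Real.sqrt_le_iff.2 ⟨by positivity, (Finset.sum_le_sum fun i _ => h i).trans ?_⟩
  rw [Finset.sum_const, Finset.card_univ, Fintype.card_fin, nsmul_eq_mul, mul_pow]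
  refine mul_le_mul_of_nonneg_right ?_ (by positivity)
  exact_mod_cast Nat.le_self_pow two_ne_zero d

/-- It suffices that the real-linear extension `L` is injective, since it is then antilipschitz.
Rounding the multiples of a nonzero kernel vector would give infinitely many lattice points with
bounded image. -/
theorem exists_vecNorm_le_of_finite_sublevels {d : ℕ} {ι : Type*} [Fintype ι]
    (l : (Fin d → ℤ) →+ (ι → ℝ)) (h : ∀ C : ℝ, {n | ‖l n‖ ≤ C}.Finite) :
    ∃ c : ℝ, 0 < c ∧ ∀ n, vecNorm n ≤ c * ‖l n‖ := by
  let e (i : Fin d) : ι → ℝ := l (Pi.single i 1)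
  let L : (Fin d → ℝ) →ₗ[ℝ] (ι → ℝ) := Fintype.linearCombination ℝ e
  have hL : ∀ x, L x = ∑ i, x i • e i := fun x => Fintype.linearCombination_apply ℝ e x
  have hLl : ∀ n : Fin d → ℤ, L (fun i => (n i : ℝ)) = l n := fun n => by
    rw [hL]
    conv_rhs => rw [← Finset.univ_sum_single n, map_sum]
    refine Finset.sum_congr rfl fun i _ => ?_
    have : Pi.single i (n i) = n i • (Pi.single i 1 : Fin d → ℤ) := by
      rw [← Pi.single_smul, smul_eq_mul, mul_one]
    rw [this, map_zsmul, Int.cast_smul_eq_zsmul]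
  have hker : L.ker = ⊥ := by
    rw [LinearMap.ker_eq_bot']
    intro x hx
    by_contra hx0
    obtain ⟨i, hi⟩ := Function.ne_iff.1 hx0
    let m (k : ℕ) : Fin d → ℤ := fun i => round (k * x i)
    have hm : ∀ k, ‖l (m k)‖ ≤ ∑ i, ‖e i‖ := fun k => by
      have hk : L (fun i => (m k i : ℝ)) = L (fun i => (m k i : ℝ) - k * x i) := by
        have : (fun i => (m k i : ℝ) - k * x i) = (fun i => (m k i : ℝ)) - (k : ℝ) • x := rfl
        rw [this, map_sub, map_smul, hx, smul_zero, sub_zero]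
      rw [← hLl, hk, hL]
      refine (norm_sum_le _ _).trans (Finset.sum_le_sum fun i _ => ?_)
      rw [norm_smul]
      refine mul_le_of_le_one_left (norm_nonneg _) ?_
      rw [Real.norm_eq_abs, abs_sub_comm]
      exact (abs_sub_round _).trans (by norm_num)
    obtain ⟨B, hB⟩ := ((h (∑ i, ‖e i‖)).image fun n => |(n i : ℝ)|).bddAbove
    obtain ⟨k, hk⟩ := exists_nat_gt ((B + 1) / |x i|)
    rw [div_lt_iff₀ (abs_pos.2 hi)] at hk
    have h1 : |(m k i : ℝ)| ≤ B := hB ⟨m k, hm k, rfl⟩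
    have h2 : |(k : ℝ) * x i - m k i| ≤ 1 := (abs_sub_round _).trans (by norm_num)
    have h3 := abs_sub_abs_le_abs_sub ((k : ℝ) * x i) (m k i)
    rw [abs_mul, Nat.abs_cast] at h3
    linarith
  obtain ⟨K, hK, hlip⟩ := L.exists_antilipschitzWith hker
  -- The summand `1` keeps the constant positive when `d = 0`.
  refine ⟨d * K + 1, by positivity, fun n => (vecNorm_le n).trans ?_⟩
  have h1 : ‖fun i => (n i : ℝ)‖ ≤ K * ‖l n‖ := by
    rw [← hLl]
    simpa using hlip.le_mul_dist (fun i => (n i : ℝ)) 0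
  have := mul_le_mul_of_nonneg_left h1 (Nat.cast_nonneg (α := ℝ) d)
  nlinarith [norm_nonneg (l n)]

end Rate

/-! ### Mixing excludes nontrivial monomials acting as the identity. -/

section Mixing

/-- The inclusion of `ℚ / ℤ` in the circle. -/
noncomputable def ratCircleHom : AddCircle (1 : ℚ) →+ AddCircle (1 : ℝ) :=
  QuotientAddGroup.map _ _ (Rat.castHom ℝ).toAddMonoidHom (by
    rintro _ ⟨n, rfl⟩
    exact ⟨n, by simp⟩)

theorem ratCircleHom_injective : Function.Injective ratCircleHom := by
  rw [injective_iff_map_eq_zero]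
  intro x
  obtain ⟨q, rfl⟩ := QuotientAddGroup.mk_surjective x
  intro h
  obtain ⟨n, hn⟩ := (QuotientAddGroup.eq_zero_iff ((q : ℝ))).1 h
  refine (QuotientAddGroup.eq_zero_iff q).2 ⟨n, ?_⟩
  simp only [zsmul_eq_mul, mul_one] at hn ⊢
  exact_mod_cast hn

/-- Characters into `ℚ / ℤ` separate points, and `ℚ / ℤ` embeds in the circle. -/
theorem exists_dualGroup_ne_one {M : Type*} [AddCommGroup M] {m : M} (hm : m ≠ 0) :
    ∃ χ : DualGroup M, χ ≠ 1 := by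
  obtain ⟨c, hc⟩ := CharacterModule.exists_character_apply_ne_zero_of_ne_zero hm
  let f : DiscreteGroup M →* Circle :=
    { toFun := fun x => AddCircle.toCircle (ratCircleHom (c (Multiplicative.toAdd x)))
      map_one' := by
        change AddCircle.toCircle (ratCircleHom (c 0)) = 1
        simp
      map_mul' := fun x y => by
        change AddCircle.toCircle (ratCircleHom (c
          (Multiplicative.toAdd x + Multiplicative.toAdd y))) = _
        rw [map_add, map_add, AddCircle.toCircle_add] }
  let χ : DualGroup M := { toMonoidHom := f, continuous_toFun := continuous_of_discreteTopology }
  refine ⟨χ, fun h => hc ?_⟩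
  have h1 : AddCircle.toCircle (ratCircleHom (c m)) = 1 :=
    DFunLike.congr_fun h (show DiscreteGroup M from Multiplicative.ofAdd m)
  rw [← AddCircle.toCircle_zero (T := (1 : ℝ))] at h1
  have h2 := AddCircle.injective_toCircle one_ne_zero h1
  exact ratCircleHom_injective (h2.trans (map_zero _).symm)

instance (M : Type*) [AddCommGroup M] : IsProbabilityMeasure (dualHaar M) :=
  ⟨Measure.haarMeasure_self⟩

instance (M : Type*) [AddCommGroup M] : (dualHaar M).IsOpenPosMeasure :=
  inferInstanceAs (Measure.haarMeasure _).IsOpenPosMeasure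

theorem u_add {d : ℕ} (m n : Fin d → ℤ) : u (m + n) = u m * u n := by
  simp [u, AddMonoidAlgebra.single_mul_single]

theorem u_zero {d : ℕ} : u (0 : Fin d → ℤ) = 1 := rfl

/-- If `u n` acts trivially, so does `u (j • n)` for all `j`, and mixing along this sequence gives
`μ(U) = μ(U)²`. Nonempty open sets then all have measure one, which two disjoint ones contradict. -/
theorem exists_u_smul_ne_of_isMixingModule {d : ℕ} {M : Type*} [AddCommGroup M]
    [Module (LaurentRing d) M] [Nontrivial M] (h : IsMixingModule d M) {n : Fin d → ℤ}
    (hn : n ≠ 0) : ∃ m : M, u n • m ≠ m := by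
  by_contra! hfix
  have hfixj : ∀ (j : ℕ) (m : M), u (j • n) • m = m := fun j m => by
    induction j with
    | zero => rw [zero_smul, u_zero, one_smul]
    | succ j ih => rw [succ_nsmul, u_add, mul_smul, hfix, ih]
  have hact : ∀ (j : ℕ) (χ : DualGroup M), dualAction M (j • n) χ = χ := fun j χ => by
    refine PontryaginDual.ext fun a => ?_
    exact congrArg χ (hfixj j (Multiplicative.toAdd a))
  have hinj : Function.Injective fun j : ℕ => j • n := fun i j hij => by
    obtain ⟨k, hk⟩ := Function.ne_iff.1 hn
    have := congrFun hij k
    have hmul : (i : ℤ) * n k = j * n k := by simpa only [Pi.smul_apply, nsmul_eq_mul] using this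
    exact_mod_cast mul_left_injective₀ hk hmul
  have hlim : Tendsto (fun j : ℕ => j • n) atTop cofinite :=
    Nat.cofinite_eq_atTop ▸ hinj.tendsto_cofinite
  have hone : ∀ U : Set (DualGroup M), IsOpen U → U.Nonempty → dualHaar M U = 1 := by
    intro U hU hne
    have h1 := (h U U hU.measurableSet hU.measurableSet).comp hlim
    have h2 : ((fun n => dualHaar M (U ∩ dualAction M n ⁻¹' U)) ∘ fun j : ℕ => j • n) =
        fun _ => dualHaar M U := by
      funext j
      have : dualAction M (j • n) ⁻¹' U = U := by
        ext χ
        rw [Set.mem_preimage, hact]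
      rw [Function.comp_apply, this, Set.inter_self]
    rw [h2, tendsto_const_nhds_iff] at h1
    have h0 := (hU.measure_pos (dualHaar M) hne).ne'
    have h3 : dualHaar M U * 1 = dualHaar M U * dualHaar M U := by rwa [mul_one]
    exact ((ENNReal.mul_right_inj h0 (measure_ne_top _ _)).1 h3).symm
  obtain ⟨m, hm⟩ := exists_ne (0 : M)
  obtain ⟨χ, hχ⟩ := exists_dualGroup_ne_one hm
  obtain ⟨U, V, hU, hV, hχU, hV1, hUV⟩ := t2_separation hχ
  have hle := prob_le_one (μ := dualHaar M) (s := U ∪ V)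
  rw [measure_union hUV hV.measurableSet, hone U hU ⟨_, hχU⟩, hone V hV ⟨_, hV1⟩] at hle
  norm_num at hle

end Mixing

/-! ### Independence of the chosen normalisation. -/

section Normalization

variable {K : Type*} [Field K] {N : Place K → K → ℝ}

theorem IsNormalization.map_mul (hN : IsNormalization N) (q : Place K) (x y : K) :
    N q (x * y) = N q x * N q y := by
  obtain ⟨w, -, c, -, h⟩ := hN q
  rw [h, h, h, w.1.map_mul, Real.mul_rpow (w.1.nonneg _) (w.1.nonneg _)]

theorem IsNormalization.pos (hN : IsNormalization N) (q : Place K) {x : K} (hx : x ≠ 0) :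
    0 < N q x := by
  obtain ⟨w, -, c, -, h⟩ := hN q
  rw [h]
  exact Real.rpow_pos_of_pos (w.1.pos hx) c

theorem mem_unboundedPlaces_iff {D : Type} [CommRing D] [IsDomain D]
    {N : Place (FractionRing D) → FractionRing D → ℝ} (hN : IsNormalization N)
    (v : {v : AbsoluteValue (FractionRing D) ℝ // v.IsNontrivial}) :
    Quotient.mk (placeSetoid _) v ∈ unboundedPlaces D N ↔ IsUnboundedOn D v.1 := by
  obtain ⟨w, hw, c, hc, h⟩ := hN (Quotient.mk (placeSetoid _) v)
  have hwv : w.1.IsEquiv v.1 := Quotient.exact hw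
  constructor
  · intro hv
    by_contra hb
    refine hv ⟨1, ?_⟩
    rintro _ ⟨a, rfl⟩
    simp only [h]
    exact Real.rpow_le_one (w.1.nonneg _)
      (hwv.le_one_iff.2 (le_one_of_not_isUnboundedOn hb a)) hc.le
  · rintro hv ⟨C, hC⟩
    refine hv.congr hwv.symm ⟨|C| ^ c⁻¹, ?_⟩
    rintro _ ⟨a, rfl⟩
    have h1 := hC ⟨a, rfl⟩
    simp only [h] at h1
    rw [Real.le_rpow_inv_iff_of_pos (w.1.nonneg _) (abs_nonneg _) hc]
    exact h1.trans (le_abs_self C)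

end Normalization

/-! ### The sets `H_k` exhaust `M`. -/

section Boxes

variable {M : Type} [CommRing M] [IsDomain M] {N : Place (FractionRing M) → FractionRing M → ℝ}

theorem mem_upperBox_of_forall (hN : IsNormalization N) {t : ℝ} {a : M}
    (h : ∀ q ∈ unboundedPlaces M N, N q (algebraMap M (FractionRing M) a) ≤ t) :
    a ∈ upperBox M N t :=
  fun v hv => h _ ((mem_unboundedPlaces_iff hN v).2 hv)

theorem finite_placeBox (hN : IsNormalization N) (hfin : ∀ t, (upperBox M N t).Finite) (t : ℝ) :
    (placeBox M N t).Finite :=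
  Set.Finite.union ((hfin t).subset fun _ ha => mem_upperBox_of_forall hN fun q hq => (ha q hq).2)
    (Set.finite_singleton 0)

theorem placeBox_mono {s t : ℝ} (hs : 0 < s) (hst : s ≤ t) : placeBox M N s ⊆ placeBox M N t :=
  Set.union_subset_union_left _ fun _ ha q hq =>
    ⟨(inv_anti₀ hs hst).trans (ha q hq).1, (ha q hq).2.trans hst⟩

theorem isExhaustive_placeBox (hN : IsNormalization N) (hS : (unboundedPlaces M N).Finite)
    (hfin : ∀ t, (upperBox M N t).Finite) {θ : ℕ → ℝ} (hθ_pos : ∀ k, 0 < θ k)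
    (hθ_mono : Monotone θ) (hθ_lim : Tendsto θ atTop atTop) :
    IsExhaustive fun k => placeBox M N (θ k) := by
  refine ⟨fun i j hij => placeBox_mono (hθ_pos i) (hθ_mono hij),
    fun k => finite_placeBox hN hfin _, Set.eq_univ_of_forall fun a => ?_⟩
  rw [Set.mem_iUnion]
  rcases eq_or_ne a 0 with rfl | ha
  · exact ⟨0, Or.inr rfl⟩
  · have haK : algebraMap M (FractionRing M) a ≠ 0 := by simpa using ha
    -- Finiteness of `S(𝔭)` lets one `k` serve all its places.
    obtain ⟨k, hk⟩ := ((eventually_all_finite hS).2 fun q _ =>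
      (hθ_lim.eventually_ge_atTop (N q (algebraMap M (FractionRing M) a))⁻¹).and
      (hθ_lim.eventually_ge_atTop (N q (algebraMap M (FractionRing M) a)))).exists
    exact ⟨k, Or.inl fun q hq => ⟨inv_le_of_inv_le₀ (hN.pos q haK) (hk q hq).1, (hk q hq).2⟩⟩

end Boxes

/-! ### The logarithmic rate. -/

section Uniform

variable {d : ℕ} {M : Type} [CommRing M] [IsDomain M] [Algebra (LaurentRing d) M]
  {N : Place (FractionRing M) → FractionRing M → ℝ}

theorem algebraMap_u_injective (hmix : IsMixingModule d M) :
    Function.Injective fun n : Fin d → ℤ => algebraMap (LaurentRing d) M (u n) := by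
  intro m n hmn
  by_contra hne
  obtain ⟨x, hx⟩ := exists_u_smul_ne_of_isMixingModule hmix (sub_ne_zero.2 hne)
  have h1 : u (m - n) * u n = u m := by rw [← u_add, sub_add_cancel]
  have h2 : u n * u (-n) = (1 : LaurentRing d) := by rw [← u_add, add_neg_cancel, u_zero]
  refine hx ?_
  have h3 : algebraMap (LaurentRing d) M (u (m - n)) = 1 := by
    calc algebraMap (LaurentRing d) M (u (m - n))
        = algebraMap (LaurentRing d) M (u (m - n) * u n * u (-n)) := by
          rw [mul_assoc, h2, mul_one]
      _ = algebraMap (LaurentRing d) M (u m) * algebraMap (LaurentRing d) M (u (-n)) := by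
          rw [h1, map_mul]
      _ = algebraMap (LaurentRing d) M (u n) * algebraMap (LaurentRing d) M (u (-n)) := by
          rw [show algebraMap (LaurentRing d) M (u m) = algebraMap (LaurentRing d) M (u n) from hmn]
      _ = 1 := by rw [← map_mul, h2, map_one]
  rw [Algebra.smul_def, h3, one_mul]

theorem algebraMap_u_ne_zero (n : Fin d → ℤ) : algebraMap (LaurentRing d) M (u n) ≠ 0 := by
  have h2 : u n * u (-n) = (1 : LaurentRing d) := by rw [← u_add, add_neg_cancel, u_zero]
  intro h0
  have := congrArg (algebraMap (LaurentRing d) M) h2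
  rw [map_mul, h0, zero_mul, map_one] at this
  exact zero_ne_one this

/-- The logarithms of the normalised absolute values of `u^n` at a set of places. -/
noncomputable def logHom (hN : IsNormalization N) (S : Set (Place (FractionRing M))) :
    (Fin d → ℤ) →+ (S → ℝ) :=
  AddMonoidHom.mk' (fun n q => Real.log (N q.1 (algebraMap M (FractionRing M)
    (algebraMap (LaurentRing d) M (u n))))) fun m n => by
    funext q
    have hne : ∀ n : Fin d → ℤ,
        algebraMap M (FractionRing M) (algebraMap (LaurentRing d) M (u n)) ≠ 0 := fun n => by
      simpa using algebraMap_u_ne_zero n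
    rw [Pi.add_apply, ← Real.log_mul (hN.pos _ (hne m)).ne' (hN.pos _ (hne n)).ne', ← hN.map_mul,
      ← map_mul, ← map_mul, u_add]

theorem logHom_apply (hN : IsNormalization N) (S : Set (Place (FractionRing M)))
    (n : Fin d → ℤ) (q : S) : logHom hN S n q = Real.log (N q.1 (algebraMap M (FractionRing M)
      (algebraMap (LaurentRing d) M (u n)))) := rfl

theorem exists_uniformMixing (hN : IsNormalization N) (hS : (unboundedPlaces M N).Finite)
    (hfin : ∀ t, (upperBox M N t).Finite) (hinf : Infinite M) (hmix : IsMixingModule d M)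
    {θ : ℕ → ℝ} (hθ_pos : ∀ k, 0 < θ k) :
    ∃ B : ℝ, 0 < B ∧
      UniformMixing d (fun k => placeBox M N (θ k)) fun k => B * Real.log (θ k) := by
  have : Fintype (unboundedPlaces M N) := hS.fintype
  -- With no unbounded place a box would be all of the infinite ring `M`. The place `q₀` later
  -- yields `log θ(k) ≥ 0`.
  obtain ⟨q₀, hq₀⟩ : (unboundedPlaces M N).Nonempty := by
    rw [Set.nonempty_iff_ne_empty]
    intro h
    refine Set.infinite_univ ((hfin 0).subset fun a _ => mem_upperBox_of_forall hN fun q hq => ?_)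
    rw [h] at hq
    exact hq.elim
  obtain ⟨c, hc, hcn⟩ := exists_vecNorm_le_of_finite_sublevels
    (logHom (d := d) hN (unboundedPlaces M N)) fun C => by
      refine Set.Finite.of_finite_image (f := fun n => algebraMap (LaurentRing d) M (u n))
        ((hfin (Real.exp C)).subset ?_) (algebraMap_u_injective hmix).injOn
      rintro _ ⟨n, hn, rfl⟩
      refine mem_upperBox_of_forall hN fun q hq => ?_
      refine (Real.log_le_iff_le_exp (hN.pos q (by simpa using algebraMap_u_ne_zero n))).1 ?_
      exact (le_abs_self _).trans
        ((norm_le_pi_norm (logHom hN (unboundedPlaces M N) n) ⟨q, hq⟩).trans hn)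
  -- The factor `2` comes from one `log θ(k)` for `a` and one for `u n • a`.
  refine ⟨c * 2, by positivity, fun k n hkn => Set.Subset.antisymm ?_ ?_⟩
  · rintro _ ⟨hx, a, ha, rfl⟩
    by_contra hne
    have hx0 : u n • a ≠ 0 := hne
    have ha0 : a ≠ 0 := fun h => hx0 (by rw [h, smul_zero])
    have hxb := hx.resolve_right hx0
    have hab := ha.resolve_right ha0
    have haK : algebraMap M (FractionRing M) a ≠ 0 := by simpa using ha0
    have hlog : ∀ q ∈ unboundedPlaces M N, ∀ b : M, b ≠ 0 →
        (θ k)⁻¹ ≤ N q (algebraMap M (FractionRing M) b) ∧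
          N q (algebraMap M (FractionRing M) b) ≤ θ k →
        |Real.log (N q (algebraMap M (FractionRing M) b))| ≤ Real.log (θ k) := by
      intro q _ b hb hb2
      have hbp := hN.pos q (show algebraMap M (FractionRing M) b ≠ 0 by simpa using hb)
      rw [abs_le, ← Real.log_inv]
      exact ⟨Real.log_le_log (inv_pos.2 (hθ_pos k)) hb2.1, Real.log_le_log hbp hb2.2⟩
    have hnonneg : 0 ≤ Real.log (θ k) := (abs_nonneg _).trans (hlog q₀ hq₀ a ha0 (hab q₀ hq₀))
    have hbound : ‖logHom hN (unboundedPlaces M N) n‖ ≤ 2 * Real.log (θ k) := by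
      refine (pi_norm_le_iff_of_nonneg (by positivity)).2 fun q => ?_
      have h1 := hlog q.1 q.2 _ hx0 (hxb q.1 q.2)
      have h2 := hlog q.1 q.2 _ ha0 (hab q.1 q.2)
      have hun : algebraMap M (FractionRing M) (algebraMap (LaurentRing d) M (u n)) ≠ 0 := by
        simpa using algebraMap_u_ne_zero n
      rw [Algebra.smul_def, map_mul, hN.map_mul, Real.log_mul (hN.pos _ hun).ne'
        (hN.pos _ haK).ne', ← logHom_apply hN (unboundedPlaces M N) n q] at h1
      rw [Real.norm_eq_abs]
      rw [abs_le] at *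
      constructor <;> linarith
    have h3 := hcn n
    have h4 := mul_le_mul_of_nonneg_left hbound hc.le
    rw [← mul_assoc] at h4
    exact absurd hkn (not_lt.2 (h3.trans h4))
  · rintro _ rfl
    exact ⟨Or.inr rfl, 0, Or.inr rfl, smul_zero _⟩

end Uniform

end AlgebraicAction

open AlgebraicAction in
theorem theorem2 (d : ℕ) (p : Ideal (LaurentRing d)) [hp : p.IsPrime]
    (hdim : ringKrullDim (LaurentRing d ⧸ p) = 1)
    (hmix : IsMixingModule d (LaurentRing d ⧸ p))
    (N : Place (FractionRing (LaurentRing d ⧸ p)) → FractionRing (LaurentRing d ⧸ p) → ℝ)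
    (hN : IsNormalization N)
    (θ : ℕ → ℝ) (hθ_pos : ∀ k, 0 < θ k) (hθ_mono : Monotone θ)
    (hθ_lim : Tendsto θ atTop atTop) :
    ∃ H : ℕ → Set (LaurentRing d ⧸ p), ∃ B : ℝ, 0 < B ∧
      (∀ k, H k = placeBox (LaurentRing d ⧸ p) N (θ k)) ∧
      IsExhaustive H ∧
      UniformMixing d H (fun k => B * Real.log (θ k)) := by
  have hfield : ¬ IsField (LaurentRing d ⧸ p) := fun h => by
    rw [ringKrullDim_eq_zero_of_isField h] at hdim
    exact zero_ne_one hdim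
  have hinf : Infinite (LaurentRing d ⧸ p) := by
    by_contra h
    rw [not_infinite_iff_finite] at h
    exact hfield (Finite.isField_of_domain _)
  have : Ring.KrullDimLE 1 (LaurentRing d ⧸ p) := Ring.krullDimLE_iff.2 hdim.le
  have : @Algebra.FiniteType ℤ (LaurentRing d ⧸ p) _ _ (Ring.toIntAlgebra _) := by
    convert! Algebra.FiniteType.of_surjective (Ideal.Quotient.mkₐ ℤ p)
      (Ideal.Quotient.mkₐ_surjective ℤ p)
  obtain ⟨hS, hfin⟩ := finite_places_and_boxes_of_finiteType hfield
  have hS' : (unboundedPlaces (LaurentRing d ⧸ p) N).Finite := hS.subset fun q hq => by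
    obtain ⟨v, rfl⟩ := Quotient.exists_rep q
    exact ⟨v, rfl, (mem_unboundedPlaces_iff hN v).1 hq⟩
  obtain ⟨B, hB, hmixB⟩ := exists_uniformMixing hN hS' (hfin N hN) hinf hmix hθ_pos
  exact ⟨_, B, hB, fun _ => rfl,
    isExhaustive_placeBox hN hS' (hfin N hN) hθ_pos hθ_mono hθ_lim, hmixB⟩
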